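/- Fix the following source language and target machine. Programs consist of finitely many components; the interface $I$ of a program lists, for each component, the procedures it exports and the procedures of other components that it imports. A whole program has a fixed main component that contains a fixed main procedure, and every import is exported by a declared component. $P : I$ means that $P$ is a well-formed whole program with interface $I$. The events are cross-component calls $C\ \mathtt{Call}(P,n)\ C'$ and returns $C\ \mathtt{Return}(n)\ C'$ with integer $n$. Traces are finite or infinite sequences of events; a finite trace ends with termination, with silent divergence, or with $\mathtt{Undef}(C)$ when component $C$ encounters undefined behavior. $P \rightsquigarrow t$ means that $P$ has an execution with trace $t$, and $P \rightsquigarrow^* m$ that $P \rightsquigarrow t$ for some $t$ that extends the finite prefix $m$ (which may record that execution has terminated). A prefix is defined if it does not end with $\mathtt{Undef}(C)$. The source language is an unsafe, expression-based language with values (integers, pointers, the undefined value $\top$), a static buffer $\mathtt{local}$ per component, binary operations, sequencing, conditionals, allocation, dereferencing, assignment, procedure calls and $\mathtt{exit}$. The target is the compartmentalized machine: a register machine with the same block-based memory, partitioned by components, and with a protected stack for cross-component calls and returns, which are checked against the interface. The back-translation $\uparrow$ takes a finite trace prefix $m$ and an interface $I$ and yields the source program $(m,I)\uparrow$ with interface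 $I$ in which each component $C$ has a one-cell buffer, initially $\mathtt{local[0]}=0$, and the procedures exported by $C$ (and the main procedure, if $C$ is the main component). Let $e_0,\dots,e_{r-1}$ be the events of $m$ emitted by $C$, in order. The body of each procedure $P$ of $C$ is $$\mathtt{if\ (local[0]==0)\ \{local[0]{+}{+};}\ b_0\mathtt{\}\ else\ if\ (local[0]==1)\ \{local[0]{+}{+};}\ b_1\mathtt{\}\ \cdots\ else\ exit},$$ where $b_i$ is $\mathtt{C'.P'(n);\ C.P(0)}$ if $e_i$ is the call $C\ \mathtt{Call}(P',n)\ C'$, and $\mathtt{return}\ n$ if $e_i$ is a return of $n$. **Theorem (Back-translation).** 1. $\uparrow$ satisfies the back-translation assumption: for every interface $I$, every whole machine program $P : I$ and every defined finite trace prefix $m$, $$P \rightsquigarrow^* m \ \Longrightarrow\ (m,I)\uparrow\ :\ I \ \wedge\ (m,I)\uparrow\ \rightsquigarrow^* m.$$ 2. Let $I$ be the interface of a whole program and $m$ a defined finite trace prefix that is well formed for $I$: the events start in the main component, only the component in control emits events, every cross-component call goes to another component and is allowed by $I$, and every return matches the innermost pending call. Then $(m,I)\uparrow : I$ and $(m,I)\uparrow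 \rightsquigarrow^* m$. Moreover $\mathtt{local[0]}$ counts events: for every initial segment $m'$ of the events of $m$, the program $(m,I)\uparrow$ can reach a state in which it has emitted exactly $m'$ and in which $\mathtt{local[0]}$ of each component $C$ holds the number of events of $m'$ emitted by $C$. -/

import Mathlib

/-! Names, interfaces, values, memory and events shared by the source language and the
compartmentalized machine. -/

namespace SecComp

abbrev CompId := ℕ
abbrev ProcId := ℕ
abbrev Label := ℕ

/-- Finite partial maps. -/
structure PMap (α β : Type) where
  get : α → Option β
  finite_dom : {a | get a ≠ none}.Finite

/-- The interface of one component: the procedures it exports, and the procedures of other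
components that it imports. -/
structure CompInterface where
  exports : Finset ProcId
  imports : Finset (CompId × ProcId)

/-- The interface of a program: finitely many components, each with its interface. -/
abbrev Interface := PMap CompId CompInterface

/-- The distinguished component and procedure in which every whole program starts. -/
def mainComp : CompId := 0
def mainProc : ProcId := 0

namespace Interface

def Declares (I : Interface) (C : CompId) : Prop := I.get C ≠ none

def Exports (I : Interface) (C : CompId) (P : ProcId) : Prop :=
  ∃ ci, I.get C = some ci ∧ P ∈ ci.exports

/-- Component `C` imports procedure `P` of component `C'`. -/
def Imports (I : Interface) (C C' : CompId) (P : ProcId) : Prop :=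
  ∃ ci, I.get C = some ci ∧ (C', P) ∈ ci.imports

/-- Interfaces of whole programs: every import is exported by a declared component, and the main
component is declared. -/
structure Whole (I : Interface) : Prop where
  closed : ∀ C C' P, I.Imports C C' P → I.Exports C' P
  main_declared : I.Declares mainComp

end Interface

/-- Block identifiers. A block holds either the code of a procedure (machine only) or data. -/
inductive Block where
  | code (P : ProcId)
  | data (b : ℕ)
  deriving DecidableEq

/-- A pointer: the owning component, a block of that component, an offset into the block. -/
structure Pointer where
  comp : CompId
  block : Block
  off : ℤ
  deriving DecidableEq

def Pointer.add (p : Pointer) (n : ℤ) : Pointer := { p with off := p.off + n }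

/-- Values: integers, pointers, and the undefined value `⊤`. -/
inductive Value where
  | int (n : ℤ)
  | ptr (p : Pointer)
  | undef

def Value.IsPtr : Value → Prop
  | .ptr _ => True
  | _ => False

inductive Binop where
  | add | sub | mul | eq | le

def Value.ofProp (q : Prop) [Decidable q] : Value := .int (if q then 1 else 0)

/-- On pointers: equality, ordering inside one block, and offset changes. Every other combination
(including any use of `⊤`) gives `⊤`. -/
def Binop.eval : Binop → Value → Value → Value
  | .add, .int a, .int b => .int (a + b)
  | .sub, .int a, .int b => .int (a - b)
  | .mul, .int a, .int b => .int (a * b)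
  | .eq, .int a, .int b => .ofProp (a = b)
  | .le, .int a, .int b => .ofProp (a ≤ b)
  | .add, .ptr p, .int n => .ptr (p.add n)
  | .add, .int n, .ptr p => .ptr (p.add n)
  | .sub, .ptr p, .int n => .ptr (p.add (-n))
  | .eq, .ptr p, .ptr q => .ofProp (p = q)
  | .le, .ptr p, .ptr q =>
      if p.comp = q.comp ∧ p.block = q.block then .ofProp (p.off ≤ q.off) else .undef
  | _, _, _ => .undef

/-- For each component, the list of its data blocks allocated so far (block `data b` is the `b`-th
one); each block is a finite array of values. -/
abbrev Memory := CompId → List (List Value)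

namespace Memory

/-- `none` for code blocks, for blocks that are not allocated and for offsets out of bounds. -/
def load (mem : Memory) (p : Pointer) : Option Value :=
  match p.block with
  | .code _ => none
  | .data b => if 0 ≤ p.off then (mem p.comp)[b]?.bind (fun blk => blk[p.off.toNat]?) else none

/-- Defined exactly where `load` is. -/
def store (mem : Memory) (p : Pointer) (v : Value) : Option Memory :=
  match p.block, mem.load p with
  | .data b, some _ =>
      some (Function.update mem p.comp
        ((mem p.comp).modify b (fun blk => blk.set p.off.toNat v)))
  | _, _ => none

/-- Allocation of a fresh block of `n` uninitialized cells for component `C`. It never fails. -/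
def alloc (mem : Memory) (C : CompId) (n : ℕ) : Memory × Pointer :=
  (Function.update mem C (mem C ++ [List.replicate n Value.undef]),
    { comp := C, block := .data (mem C).length, off := 0 })

end Memory

/-- `call C P n C'`: component `C` calls procedure `P` of component `C'` with argument `n`.
`ret C n C'`: component `C` returns `n` to component `C'`. -/
inductive Event where
  | call (C : CompId) (P : ProcId) (n : ℤ) (C' : CompId)
  | ret (C : CompId) (n : ℤ) (C' : CompId)

/-- The component that emits the event. -/
def Event.source : Event → CompId
  | .call C _ _ _ => C
  | .ret C _ _ => C

/-! Labelled transition systems and their traces. -/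

/-- Complete traces: they end with termination, with silent divergence, or with the undefined
behavior of some component, or they are infinite. -/
inductive Trace where
  | terminates (t : List Event)
  | diverges (t : List Event)
  | reacts (t : ℕ → Event)
  | undef (t : List Event) (C : CompId)

/-- Finite trace prefixes: an execution that may go on, one that has terminated, one that has
ended with the undefined behavior of component `C`. -/
inductive FinTrace where
  | ongoing (t : List Event)
  | terminated (t : List Event)
  | undef (t : List Event) (C : CompId)

def FinTrace.events : FinTrace → List Event
  | .ongoing t => t
  | .terminated t => t
  | .undef t _ => t

/-- The trace prefix does not end with an undefined behavior. -/
def FinTrace.Defined : FinTrace → Prop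
  | .undef _ _ => False
  | _ => True

/-- The relation `m ≤ t`. -/
def FinTrace.LE : FinTrace → Trace → Prop
  | .ongoing m, .terminates t => m <+: t
  | .ongoing m, .diverges t => m <+: t
  | .ongoing m, .reacts t => ∀ i e, m[i]? = some e → e = t i
  | .ongoing m, .undef t _ => m <+: t
  | .terminated m, .terminates t => m = t
  | .undef m C, .undef t C' => m = t ∧ C = C'
  | _, _ => False

/-- A labelled transition system; the label `none` marks silent steps, and `comp s` is the
component that has control in state `s`. -/
structure LTS where
  State : Type
  step : State → Option Event → State → Prop
  initial : State → Prop
  final : State → Prop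
  comp : State → CompId

namespace LTS

/-- Finite executions with the list of the events they emit. -/
inductive Star (L : LTS) : L.State → List Event → L.State → Prop
  | refl (s : L.State) : Star L s [] s
  | step {s s' s'' : L.State} {a : Option Event} {t : List Event} :
      L.step s a s' → Star L s' t s'' → Star L s (a.toList ++ t) s''

/-- The traces of executions that start in state `s`. -/
inductive BehavesFrom (L : LTS) (s : L.State) : Trace → Prop
  | terminates {t s'} : L.Star s t s' → L.final s' → BehavesFrom L s (.terminates t)
  | diverges {t} (f : ℕ → L.State) : L.Star s t (f 0) → (∀ n, L.step (f n) none (f (n + 1))) →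
      BehavesFrom L s (.diverges t)
  | reacts {t : ℕ → Event} (f : ℕ → L.State) : f 0 = s →
      (∀ n, L.Star (f n) [t n] (f (n + 1))) → BehavesFrom L s (.reacts t)
  | undef {t s'} : L.Star s t s' → ¬ L.final s' → (∀ a s'', ¬ L.step s' a s'') →
      BehavesFrom L s (.undef t (L.comp s'))

/-- The relation `⇝` between programs and traces. -/
def Behaves (L : LTS) (t : Trace) : Prop := ∃ s, L.initial s ∧ L.BehavesFrom s t

/-- The relation `⇝*` between programs and finite trace prefixes. -/
def Produces (L : LTS) (m : FinTrace) : Prop := ∃ t, m.LE t ∧ L.Behaves t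

end LTS

/-! The source language. -/

namespace Source

inductive Expr where
  | val (v : Value)
  | arg
  | localBuf
  | binop (op : Binop) (e₁ e₂ : Expr)
  | seq (e₁ e₂ : Expr)
  | cond (e₁ e₂ e₃ : Expr)
  | alloc (e : Expr)
  | deref (e : Expr)
  | assign (e₁ e₂ : Expr)
  | call (C : CompId) (P : ProcId) (e : Expr)
  | exit

/-- A program: its interface, the procedures of each component, and the initial contents of the
static buffer `local` of each component. -/
structure Program where
  iface : Interface
  procs : PMap CompId (PMap ProcId Expr)
  buffers : PMap CompId (List Value)

def Program.findProc (p : Program) (C : CompId) (P : ProcId) : Option Expr :=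
  (p.procs.get C).bind (fun ps => ps.get P)

/-- Well-formed code of component `C`: pointers do not occur as literals, calls inside the
component go to existing procedures, calls to other components are imported. -/
def Expr.WellFormed (p : Program) (C : CompId) : Expr → Prop
  | .val v => ¬ v.IsPtr
  | .arg => True
  | .localBuf => True
  | .binop _ e₁ e₂ => e₁.WellFormed p C ∧ e₂.WellFormed p C
  | .seq e₁ e₂ => e₁.WellFormed p C ∧ e₂.WellFormed p C
  | .cond e₁ e₂ e₃ => e₁.WellFormed p C ∧ e₂.WellFormed p C ∧ e₃.WellFormed p C
  | .alloc e => e.WellFormed p C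
  | .deref e => e.WellFormed p C
  | .assign e₁ e₂ => e₁.WellFormed p C ∧ e₂.WellFormed p C
  | .call C' P e =>
      (C' = C → p.findProc C P ≠ none) ∧ (C' ≠ C → p.iface.Imports C C' P) ∧ e.WellFormed p C
  | .exit => True

/-- Well-formed whole programs. -/
structure Program.Whole (p : Program) : Prop where
  iface_whole : p.iface.Whole
  procs_dom : ∀ C, p.procs.get C ≠ none ↔ p.iface.Declares C
  buffers_dom : ∀ C, p.buffers.get C ≠ none ↔ p.iface.Declares C
  exports_exist : ∀ C P, p.iface.Exports C P → p.findProc C P ≠ none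
  main_exists : p.findProc mainComp mainProc ≠ none
  procs_wf : ∀ C P e, p.findProc C P = some e → e.WellFormed p C
  buffers_wf : ∀ C buf, p.buffers.get C = some buf → buf ≠ [] ∧ ∀ v ∈ buf, ¬ v.IsPtr

/-- `p : I`, for whole programs. -/
def Program.Satisfies (p : Program) (I : Interface) : Prop := p.Whole ∧ p.iface = I

/-- Continuations. In an assignment the right-hand side is evaluated first. -/
inductive Cont where
  | done
  | binop₁ (op : Binop) (e₂ : Expr) (k : Cont)
  | binop₂ (op : Binop) (v₁ : Value) (k : Cont)
  | seq (e₂ : Expr) (k : Cont)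
  | cond (e₂ e₃ : Expr) (k : Cont)
  | alloc (k : Cont)
  | deref (k : Cont)
  | assign₁ (e₁ : Expr) (k : Cont)
  | assign₂ (v₂ : Value) (k : Cont)
  | call (C : CompId) (P : ProcId) (k : Cont)

/-- A frame of the call stack: the calling component, the argument of its current procedure, and
its continuation. -/
structure Frame where
  comp : CompId
  arg : Value
  cont : Cont

/-- The component that has control, the call stack, the memory, the continuation, the expression
under evaluation, and the argument of the current procedure. -/
structure State where
  comp : CompId
  stack : List Frame
  mem : Memory
  cont : Cont
  expr : Expr
  arg : Value

inductive Step (p : Program) : State → Option Event → State → Prop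
  | arg {C σ mem k a} :
      Step p ⟨C, σ, mem, k, .arg, a⟩ none ⟨C, σ, mem, k, .val a, a⟩
  | localBuf {C σ mem k a} :
      Step p ⟨C, σ, mem, k, .localBuf, a⟩ none ⟨C, σ, mem, k, .val (.ptr ⟨C, .data 0, 0⟩), a⟩
  | binop {C σ mem k op e₁ e₂ a} :
      Step p ⟨C, σ, mem, k, .binop op e₁ e₂, a⟩ none ⟨C, σ, mem, .binop₁ op e₂ k, e₁, a⟩
  | binop₁ {C σ mem k op v₁ e₂ a} :
      Step p ⟨C, σ, mem, .binop₁ op e₂ k, .val v₁, a⟩ none ⟨C, σ, mem, .binop₂ op v₁ k, e₂, a⟩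
  | binop₂ {C σ mem k op v₁ v₂ a} :
      Step p ⟨C, σ, mem, .binop₂ op v₁ k, .val v₂, a⟩ none
        ⟨C, σ, mem, k, .val (op.eval v₁ v₂), a⟩
  | seq {C σ mem k e₁ e₂ a} :
      Step p ⟨C, σ, mem, k, .seq e₁ e₂, a⟩ none ⟨C, σ, mem, .seq e₂ k, e₁, a⟩
  | seqEnd {C σ mem k v e₂ a} :
      Step p ⟨C, σ, mem, .seq e₂ k, .val v, a⟩ none ⟨C, σ, mem, k, e₂, a⟩
  | cond {C σ mem k e₁ e₂ e₃ a} :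
      Step p ⟨C, σ, mem, k, .cond e₁ e₂ e₃, a⟩ none ⟨C, σ, mem, .cond e₂ e₃ k, e₁, a⟩
  | condTrue {C σ mem k n e₂ e₃ a} : n ≠ 0 →
      Step p ⟨C, σ, mem, .cond e₂ e₃ k, .val (.int n), a⟩ none ⟨C, σ, mem, k, e₂, a⟩
  | condFalse {C σ mem k e₂ e₃ a} :
      Step p ⟨C, σ, mem, .cond e₂ e₃ k, .val (.int 0), a⟩ none ⟨C, σ, mem, k, e₃, a⟩
  | alloc {C σ mem k e a} :
      Step p ⟨C, σ, mem, k, .alloc e, a⟩ none ⟨C, σ, mem, .alloc k, e, a⟩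
  | allocEnd {C σ mem k n a} : 0 < n →
      Step p ⟨C, σ, mem, .alloc k, .val (.int n), a⟩ none
        ⟨C, σ, (mem.alloc C n.toNat).1, k, .val (.ptr (mem.alloc C n.toNat).2), a⟩
  | deref {C σ mem k e a} :
      Step p ⟨C, σ, mem, k, .deref e, a⟩ none ⟨C, σ, mem, .deref k, e, a⟩
  | derefEnd {C σ mem k ptr v a} : ptr.comp = C → mem.load ptr = some v →
      Step p ⟨C, σ, mem, .deref k, .val (.ptr ptr), a⟩ none ⟨C, σ, mem, k, .val v, a⟩
  | assign {C σ mem k e₁ e₂ a} :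
      Step p ⟨C, σ, mem, k, .assign e₁ e₂, a⟩ none ⟨C, σ, mem, .assign₁ e₁ k, e₂, a⟩
  | assign₁ {C σ mem k e₁ v₂ a} :
      Step p ⟨C, σ, mem, .assign₁ e₁ k, .val v₂, a⟩ none ⟨C, σ, mem, .assign₂ v₂ k, e₁, a⟩
  | assign₂ {C σ mem mem' k ptr v₂ a} : ptr.comp = C → mem.store ptr v₂ = some mem' →
      Step p ⟨C, σ, mem, .assign₂ v₂ k, .val (.ptr ptr), a⟩ none ⟨C, σ, mem', k, .val v₂, a⟩
  | call {C σ mem k C' P e a} :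
      Step p ⟨C, σ, mem, k, .call C' P e, a⟩ none ⟨C, σ, mem, .call C' P k, e, a⟩
  | callInternal {C σ mem k P v body a} : p.findProc C P = some body →
      Step p ⟨C, σ, mem, .call C P k, .val v, a⟩ none ⟨C, ⟨C, a, k⟩ :: σ, mem, .done, body, v⟩
  | callExternal {C σ mem k C' P n body a} : C ≠ C' → p.iface.Imports C C' P →
      p.findProc C' P = some body →
      Step p ⟨C, σ, mem, .call C' P k, .val (.int n), a⟩ (some (.call C P n C'))
        ⟨C', ⟨C, a, k⟩ :: σ, mem, .done, body, .int n⟩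
  | retInternal {C σ mem k v a a'} :
      Step p ⟨C, ⟨C, a', k⟩ :: σ, mem, .done, .val v, a⟩ none ⟨C, σ, mem, k, .val v, a'⟩
  | retExternal {C σ mem k C' n a a'} : C ≠ C' →
      Step p ⟨C, ⟨C', a', k⟩ :: σ, mem, .done, .val (.int n), a⟩ (some (.ret C n C'))
        ⟨C', σ, mem, k, .val (.int n), a'⟩

/-- Block `data 0` of each component is its static buffer. -/
def Program.initMem (p : Program) : Memory := fun C => (p.buffers.get C).toList

/-- Execution starts with the body of the main procedure, on an empty stack. -/
def Program.Initial (p : Program) (s : State) : Prop :=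
  ∃ body, p.findProc mainComp mainProc = some body ∧
    s = ⟨mainComp, [], p.initMem, .done, body, .int 0⟩

/-- Execution terminates at `exit`, and when the main procedure returns. -/
def Final (s : State) : Prop :=
  s.expr = .exit ∨ (s.stack = [] ∧ s.cont = .done ∧ ∃ v, s.expr = .val v)

def Program.lts (p : Program) : LTS where
  State := State
  step := Step p
  initial := p.Initial
  final := Final
  comp := State.comp

end Source

/-! The compartmentalized machine. -/

namespace Machine

inductive Reg where
  | one | com | sp | ra | aux₁ | aux₂
  deriving DecidableEq

/-- Immediates: integers, and pointers to static buffers. -/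
inductive Imm where
  | int (n : ℤ)
  | ptr (p : Pointer)

def Imm.toValue : Imm → Value
  | .int n => .int n
  | .ptr p => .ptr p

inductive Instr where
  | nop
  | halt
  | const (i : Imm) (r : Reg)
  | mov (rs rd : Reg)
  | binop (op : Binop) (r₁ r₂ rd : Reg)
  | load (rp rd : Reg)
  | store (rp rs : Reg)
  | jal (l : Label)
  | jump (r : Reg)
  | call (C : CompId) (P : ProcId)
  | ret
  | bnz (r : Reg) (l : Label)
  | alloc (rp rsize : Reg)

/-- A program: its interface, the code of each procedure of each component, the code position
(procedure, index) of each label of a component, and the static buffers of each component. -/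
structure Program where
  iface : Interface
  procs : PMap CompId (PMap ProcId (List Instr))
  labels : CompId → PMap Label (ProcId × ℕ)
  buffers : PMap CompId (List (List Value))

def Program.findProc (p : Program) (C : CompId) (P : ProcId) : Option (List Instr) :=
  (p.procs.get C).bind (fun ps => ps.get P)

/-- The code pointer that label `l` of component `C` denotes. -/
def Program.labelPtr (p : Program) (C : CompId) (l : Label) : Option Pointer :=
  ((p.labels C).get l).map (fun q => ⟨C, .code q.1, q.2⟩)

def Instr.WellFormed (p : Program) (C : CompId) : Instr → Prop
  | .const (.ptr q) _ => q.comp = C ∧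
      ∃ b bufs, q.block = .data b ∧ p.buffers.get C = some bufs ∧ b < bufs.length
  | .jal l => (p.labels C).get l ≠ none
  | .bnz _ l => (p.labels C).get l ≠ none
  | .call C' P => p.iface.Imports C C' P
  | _ => True

/-- Well-formed whole programs. -/
structure Program.Whole (p : Program) : Prop where
  iface_whole : p.iface.Whole
  procs_dom : ∀ C, p.procs.get C ≠ none ↔ p.iface.Declares C
  buffers_dom : ∀ C, p.buffers.get C ≠ none ↔ p.iface.Declares C
  exports_exist : ∀ C P, p.iface.Exports C P → p.findProc C P ≠ none
  main_exists : p.findProc mainComp mainProc ≠ none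
  procs_wf : ∀ C P code, p.findProc C P = some code → ∀ i ∈ code, i.WellFormed p C
  buffers_wf : ∀ C bufs, p.buffers.get C = some bufs → ∀ buf ∈ bufs, ∀ v ∈ buf, ¬ v.IsPtr

/-- `p : I`, for whole programs. -/
def Program.Satisfies (p : Program) (I : Interface) : Prop := p.Whole ∧ p.iface = I

abbrev RegFile := Reg → Value

/-- The register file in which every register is undefined. -/
def RegFile.undef : RegFile := fun _ => .undef

def RegFile.set (reg : RegFile) (r : Reg) (v : Value) : RegFile := Function.update reg r v

/-- The protected stack of cross-component calls, the memory, the registers, and the program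
counter. The component that has control is the one that owns the program counter. -/
structure State where
  stack : List Pointer
  mem : Memory
  reg : RegFile
  pc : Pointer

def Program.fetch (p : Program) (pc : Pointer) : Option Instr :=
  match pc.block with
  | .code P => if 0 ≤ pc.off then (p.findProc pc.comp P).bind (fun is => is[pc.off.toNat]?) else none
  | .data _ => none

/-- The entry point of procedure `P` of component `C`. -/
def Program.entry (p : Program) (C : CompId) (P : ProcId) : Option Pointer :=
  (p.findProc C P).map (fun _ => ⟨C, .code P, 0⟩)

inductive Step (p : Program) : State → Option Event → State → Prop
  | nop {σ mem reg pc} : p.fetch pc = some .nop →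
      Step p ⟨σ, mem, reg, pc⟩ none ⟨σ, mem, reg, pc.add 1⟩
  | const {σ mem reg pc i r} : p.fetch pc = some (.const i r) →
      Step p ⟨σ, mem, reg, pc⟩ none ⟨σ, mem, reg.set r i.toValue, pc.add 1⟩
  | mov {σ mem reg pc rs rd} : p.fetch pc = some (.mov rs rd) →
      Step p ⟨σ, mem, reg, pc⟩ none ⟨σ, mem, reg.set rd (reg rs), pc.add 1⟩
  | binop {σ mem reg pc op r₁ r₂ rd} : p.fetch pc = some (.binop op r₁ r₂ rd) →
      Step p ⟨σ, mem, reg, pc⟩ none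
        ⟨σ, mem, reg.set rd (op.eval (reg r₁) (reg r₂)), pc.add 1⟩
  | load {σ mem reg pc rp rd ptr v} : p.fetch pc = some (.load rp rd) →
      reg rp = .ptr ptr → ptr.comp = pc.comp → mem.load ptr = some v →
      Step p ⟨σ, mem, reg, pc⟩ none ⟨σ, mem, reg.set rd v, pc.add 1⟩
  | store {σ mem mem' reg pc rp rs ptr} : p.fetch pc = some (.store rp rs) →
      reg rp = .ptr ptr → ptr.comp = pc.comp → mem.store ptr (reg rs) = some mem' →
      Step p ⟨σ, mem, reg, pc⟩ none ⟨σ, mem', reg, pc.add 1⟩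
  | jal {σ mem reg pc pc' l} : p.fetch pc = some (.jal l) → p.labelPtr pc.comp l = some pc' →
      Step p ⟨σ, mem, reg, pc⟩ none ⟨σ, mem, reg.set .ra (.ptr (pc.add 1)), pc'⟩
  | jump {σ mem reg pc pc' r} : p.fetch pc = some (.jump r) → reg r = .ptr pc' →
      pc'.comp = pc.comp → Step p ⟨σ, mem, reg, pc⟩ none ⟨σ, mem, reg, pc'⟩
  | bnzTaken {σ mem reg pc pc' r l n} : p.fetch pc = some (.bnz r l) → reg r = .int n → n ≠ 0 →
      p.labelPtr pc.comp l = some pc' → Step p ⟨σ, mem, reg, pc⟩ none ⟨σ, mem, reg, pc'⟩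
  | bnzNotTaken {σ mem reg pc r l} : p.fetch pc = some (.bnz r l) → reg r = .int 0 →
      Step p ⟨σ, mem, reg, pc⟩ none ⟨σ, mem, reg, pc.add 1⟩
  | alloc {σ mem reg pc rp rsize n} : p.fetch pc = some (.alloc rp rsize) →
      reg rsize = .int n → 0 < n →
      Step p ⟨σ, mem, reg, pc⟩ none
        ⟨σ, (mem.alloc pc.comp n.toNat).1,
          reg.set rp (.ptr (mem.alloc pc.comp n.toNat).2), pc.add 1⟩
  | call {σ mem reg pc pc' C' P n} : p.fetch pc = some (.call C' P) → pc.comp ≠ C' →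
      p.iface.Imports pc.comp C' P → p.entry C' P = some pc' → reg .com = .int n →
      Step p ⟨σ, mem, reg, pc⟩ (some (.call pc.comp P n C'))
        ⟨pc.add 1 :: σ, mem,
          (RegFile.undef.set .com (.int n)).set .ra (.ptr (pc.add 1)), pc'⟩
  | ret {σ mem reg pc pc' n} : p.fetch pc = some .ret → pc.comp ≠ pc'.comp →
      reg .ra = .ptr pc' → reg .com = .int n →
      Step p ⟨pc' :: σ, mem, reg, pc⟩ (some (.ret pc.comp n pc'.comp))
        ⟨σ, mem, RegFile.undef.set .com (.int n), pc'⟩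

/-- Block `data b` of each component is its `b`-th static buffer. -/
def Program.initMem (p : Program) : Memory := fun C => (p.buffers.get C).getD []

def Program.Initial (p : Program) (s : State) : Prop :=
  ∃ pc, p.entry mainComp mainProc = some pc ∧ s = ⟨[], p.initMem, RegFile.undef, pc⟩

def Program.lts (p : Program) : LTS where
  State := State
  step := Step p
  initial := p.Initial
  final s := p.fetch s.pc = some .halt
  comp s := s.pc.comp

end Machine

/-! Well-formed traces. -/

/-- The events `t` can follow when component `C` has control and `σ` lists the components that wait
for a cross-component return, the innermost caller first: only the component in control emits
events, and every return goes back to the innermost caller. -/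
def WellBracketed : CompId → List CompId → List Event → Prop
  | _, _, [] => True
  | C, σ, .call C₁ _ _ C₂ :: t => C₁ = C ∧ C₂ ≠ C ∧ WellBracketed C₂ (C :: σ) t
  | _, [], .ret _ _ _ :: _ => False
  | C, C' :: σ, .ret C₁ _ C₂ :: t => C₁ = C ∧ C₂ = C' ∧ WellBracketed C' σ t

/-- Traces that look like those of a whole program with interface `I`: execution starts in the main
component, calls and returns are well bracketed, all calls are allowed by the interface. -/
def WellFormedTrace (I : Interface) (t : List Event) : Prop :=
  WellBracketed mainComp [] t ∧ ∀ C P n C', Event.call C P n C' ∈ t → I.Imports C C' P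

/-! The back-translation. -/

namespace Source

/-- `local[0]`, as the argument of a read or of a write. -/
def counter : Expr := .localBuf

/-- `if (local[0] == i) { local[0]++; e₁ } else e₂`. -/
def clause (i : ℕ) (e₁ e₂ : Expr) : Expr :=
  .cond (.binop .eq (.deref counter) (.val (.int i)))
    (.seq (.assign counter (.binop .add (.deref counter) (.val (.int 1)))) e₁)
    e₂

/-- The code of procedure `P` of component `C` that emits the event `ev`: after an external call,
the procedure calls itself to emit the events that remain. -/
def emit (C : CompId) (P : ProcId) : Event → Expr
  | .call _ P' n C' => .seq (.call C' P' (.val (.int n))) (.call C P (.val (.int 0)))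
  | .ret _ n _ => .val (.int n)

/-- A chain of clauses that emits the `j`-th event of the list if `local[0]` holds `i + j`, and
exits if `local[0]` is larger than all of these numbers. -/
def dispatch (C : CompId) (P : ProcId) : ℕ → List Event → Expr
  | _, [] => .exit
  | i, ev :: t => clause i (emit C P ev) (dispatch C P (i + 1) t)

/-- The body of each procedure `P` of component `C`: a dispatch over those events of `t` that are
emitted by `C`. -/
def bodyOf (t : List Event) (C : CompId) (P : ProcId) : Expr :=
  dispatch C P 0 (t.filter (fun ev => ev.source = C))

/-- The procedures of component `C`: the exported ones and, in the main component, the main one. -/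
def procsOf (t : List Event) (C : CompId) (ci : CompInterface) : PMap ProcId Expr where
  get P := if P ∈ ci.exports ∨ (C = mainComp ∧ P = mainProc) then some (bodyOf t C P) else none
  finite_dom := by
    refine (ci.exports.finite_toSet.union (Set.finite_singleton mainProc)).subset ?_
    intro P hP
    by_contra h
    simp only [Set.mem_union, Finset.mem_coe, Set.mem_singleton_iff, not_or] at h
    exact hP (if_neg (by tauto))

/-- The back-translation of the trace prefix `m` for the interface `I`. Every component has a static
buffer with one cell, its event counter, which is 0 initially. -/
def backTranslate (m : FinTrace) (I : Interface) : Program where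
  iface := I
  procs :=
    { get := fun C => (I.get C).map (procsOf m.events C)
      finite_dom := I.finite_dom.subset (fun C hC h => hC (by simp [h])) }
  buffers :=
    { get := fun C => (I.get C).map (fun _ => [.int 0])
      finite_dom := I.finite_dom.subset (fun C hC h => hC (by simp [h])) }

/-- `local[0]` counts events: for every initial segment `t` of the events of `m`, the program can
reach a state in which it has emitted `t`, and in which `local[0]` of each component holds the number
of those events of `t` that the component has emitted. -/
def Program.CountsEvents (p : Program) (m : FinTrace) : Prop :=
  ∀ t, t <+: m.events → ∃ s₀ s, p.Initial s₀ ∧ p.lts.Star s₀ t s ∧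
    ∀ C, p.iface.Declares C →
      s.mem.load ⟨C, .data 0, 0⟩ = some (.int ((t.filter (fun ev => ev.source = C)).length))

end Source

/-- The back-translation assumption for the source language and the compartmentalized machine: for
every whole machine program `P : I` and every defined `m` with `P ⇝* m`, the source program `↑(m, I)`
satisfies `↑(m, I) : I` and `↑(m, I) ⇝* m`. -/
def IsBackTranslation (bt : FinTrace → Interface → Source.Program) : Prop :=
  ∀ (I : Interface) (P : Machine.Program), P.Satisfies I →
    ∀ m : FinTrace, m.Defined → P.lts.Produces m →
      (bt m I).Satisfies I ∧ (bt m I).lts.Produces m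

end SecComp

namespace SecComp

/-! Executions. -/

namespace LTS.Star

variable {L : LTS}

/-! The first claim reduces to the second. The machine checks calls against the interface and keeps
return addresses on a protected stack, while its silent steps never leave the current component.
Hence the components of the stacked addresses are exactly the pending callers, and the events of
every defined prefix that a program produces form a well-formed trace
(`Machine.wellFormedTrace_of_produces`).

For a well-formed trace, the execution of the back-translation is followed from event to event with
the invariant `Ready`. The component in control is about to run the body of one of its procedures,
every counter holds the number of events that its component has emitted so far, and every component
waiting for a return will resume by calling one of its own procedures. Which procedure runs is
irrelevant, since all bodies of a component dispatch over the same events.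

The invariant survives one event (`Ready.star_event`). The counter selects the clause of that event
and is incremented before the event is emitted. A call starts a body of the callee and leaves a
waiting frame behind. A return first unwinds the finished internal calls that earlier self-calls
left on the stack, then wakes the innermost caller, whose self-call starts a new dispatch
(`WaitingStack.star_ret`). Induction on initial segments gives `exists_ready`, hence the counting
claim. After the last event, the next dispatch runs past all its clauses and exits
(`Ready.star_exit`), so the program terminates having emitted exactly the events of the prefix,
whether the prefix is ongoing or terminated. -/

theorem trans {s s' s'' : L.State} {t t' : List Event} (h : L.Star s t s')
    (h' : L.Star s' t' s'') : L.Star s (t ++ t') s'' := by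
  induction h with
  | refl => simpa using h'
  | step hs _ ih => rw [List.append_assoc]; exact .step hs (ih h')

theorem single {s s' : L.State} {a : Option Event} (h : L.step s a s') :
    L.Star s a.toList s' := by
  simpa using Star.step h (.refl s')

theorem silent {s s' s'' : L.State} {t : List Event} (h : L.step s none s')
    (h' : L.Star s' t s'') : L.Star s t s'' := by
  simpa using Star.step h h'

/-- Each step emits at most one event, so an execution can be cut at any point of its event list. -/
theorem exists_of_prefix {s s' : L.State} {t t' : List Event} (h : L.Star s t s')
    (ht : t' <+: t) : ∃ s'', L.Star s t' s'' := by
  induction h generalizing t' with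
  | refl s => exact ⟨s, by rw [List.prefix_nil.1 ht]; exact .refl s⟩
  | @step s s₁ s₂ a t hs _ ih =>
    cases a with
    | none =>
      obtain ⟨s'', h''⟩ := ih (by simpa using ht)
      exact ⟨s'', .silent hs h''⟩
    | some e =>
      cases t' with
      | nil => exact ⟨s, .refl s⟩
      | cons e' t' =>
        have ht : e' :: t' <+: e :: t := ht
        obtain ⟨rfl, hpre⟩ := List.cons_prefix_cons.1 ht
        obtain ⟨s'', h''⟩ := ih hpre
        exact ⟨s'', by simpa using Star.step hs h''⟩

theorem ofFn {t : ℕ → Event} {f : ℕ → L.State} (h : ∀ n, L.Star (f n) [t n] (f (n + 1)))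
    (n : ℕ) : L.Star (f 0) ((List.range n).map t) (f n) := by
  induction n with
  | zero => exact .refl _
  | succ n ih => simpa [List.range_succ] using ih.trans (h n)

end LTS.Star

/-- The events of a defined prefix are emitted by a finite execution. -/
theorem LTS.Produces.exists_star {L : LTS} {m : FinTrace} (hm : m.Defined) (h : L.Produces m) :
    ∃ s₀ s, L.initial s₀ ∧ L.Star s₀ m.events s := by
  obtain ⟨t, hle, s₀, h₀, hb⟩ := h
  suffices ∃ s, L.Star s₀ m.events s from this.elim fun s hs => ⟨s₀, s, h₀, hs⟩
  cases m with
  | undef => exact hm.elim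
  | terminated m =>
    cases hb with
    | terminates hs _ => cases hle; exact ⟨_, hs⟩
    | _ => exact hle.elim
  | ongoing m =>
    cases hb with
    | terminates hs _ => exact hs.exists_of_prefix hle
    | diverges f hs _ => exact hs.exists_of_prefix hle
    | undef hs _ _ => exact hs.exists_of_prefix hle
    | @reacts t f h0 hs =>
      subst h0
      refine ⟨f m.length, ?_⟩
      -- A finite prefix of an infinite trace is its first `m.length` events, and these are emitted
      -- by the first `m.length` segments of the execution.
      have hmt : (List.range m.length).map t = m := by
        refine List.ext_getElem (by simp) fun i h₁ h₂ => ?_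
        simpa using (hle i m[i] (List.getElem?_eq_getElem h₂)).symm
      have := LTS.Star.ofFn hs m.length
      rwa [hmt] at this

/-! Traces of the machine are well formed. -/

namespace Machine

/-- Labels denote code of their own component, register jumps are checked to stay inside it, and
only cross-component calls and returns touch the protected stack. -/
theorem Step.comp_eq {p : Program} {s s' : State} (h : Step p s none s') :
    s'.pc.comp = s.pc.comp ∧ s'.stack = s.stack := by
  have label {C l pc'} (hl : p.labelPtr C l = some pc') : pc'.comp = C := by
    obtain ⟨q, _, rfl⟩ := Option.map_eq_some_iff.1 hl
    rfl
  cases h with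
  | jal _ hl => exact ⟨label hl, rfl⟩
  | bnzTaken _ _ _ hl => exact ⟨label hl, rfl⟩
  | jump _ _ hc => exact ⟨hc, rfl⟩
  | _ => exact ⟨rfl, rfl⟩

/-- The protected stack, projected to components, is the list of pending callers that
`WellBracketed` tracks: a call pushes an address in the caller, and a return goes to the popped
address. -/
theorem wellBracketed_of_star {p : Program} {s s' : p.lts.State} {t : List Event}
    (h : p.lts.Star s t s') :
    WellBracketed (State.pc s).comp ((State.stack s).map Pointer.comp) t ∧
      ∀ C P n C', Event.call C P n C' ∈ t → p.iface.Imports C C' P := by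
  induction h with
  | refl => exact ⟨by simp [WellBracketed], by simp⟩
  | @step s s₁ s₂ a t hs _ ih =>
    obtain ⟨ih₁, ih₂⟩ := ih
    cases a with
    | none =>
      obtain ⟨hc, hσ⟩ := Step.comp_eq hs
      rw [hc, hσ] at ih₁
      exact ⟨ih₁, ih₂⟩
    | some e =>
      cases hs with
      | @call σ mem reg pc pc' C' P n _ hne himp hentry _ =>
        -- An entry point lies in the called component, so the induction hypothesis speaks of the
        -- callee.
        obtain ⟨q, _, rfl⟩ := Option.map_eq_some_iff.1 hentry
        refine ⟨⟨rfl, hne.symm, ih₁⟩, fun D Q k D' hmem => ?_⟩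
        rcases List.mem_cons.1 hmem with heq | hmem
        · cases heq; exact himp
        · exact ih₂ D Q k D' hmem
      | ret =>
        refine ⟨⟨rfl, rfl, ih₁⟩, fun D Q k D' hmem => ?_⟩
        rcases List.mem_cons.1 hmem with heq | hmem
        · cases heq
        · exact ih₂ D Q k D' hmem

theorem wellFormedTrace_of_produces {p : Program} {m : FinTrace} (hm : m.Defined)
    (h : p.lts.Produces m) : WellFormedTrace p.iface m.events := by
  obtain ⟨s₀, s, ⟨pc, hpc, rfl⟩, hs⟩ := h.exists_star hm
  obtain ⟨q, _, rfl⟩ := Option.map_eq_some_iff.1 hpc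
  exact wellBracketed_of_star hs

end Machine

/-! The back-translation is well formed. -/

namespace Source

theorem findProc_backTranslate {m : FinTrace} {I : Interface} {C : CompId} {P : ProcId}
    {ci : CompInterface} (hC : I.get C = some ci)
    (hP : P ∈ ci.exports ∨ (C = mainComp ∧ P = mainProc)) :
    (backTranslate m I).findProc C P = some (bodyOf m.events C P) := by
  simp only [Program.findProc, backTranslate, hC, Option.map_some, Option.bind_some, procsOf]
  exact if_pos hP

theorem findProc_backTranslate_of_exports {m : FinTrace} {I : Interface} {C : CompId} {P : ProcId}
    (h : I.Exports C P) : (backTranslate m I).findProc C P = some (bodyOf m.events C P) := by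
  obtain ⟨ci, hC, hP⟩ := h
  exact findProc_backTranslate hC (.inl hP)

theorem findProc_backTranslate_main {m : FinTrace} {I : Interface} (h : I.Declares mainComp) :
    (backTranslate m I).findProc mainComp mainProc =
      some (bodyOf m.events mainComp mainProc) := by
  obtain ⟨ci, hC⟩ := Option.ne_none_iff_exists'.1 h
  exact findProc_backTranslate hC (.inr ⟨rfl, rfl⟩)

theorem of_findProc_backTranslate {m : FinTrace} {I : Interface} {C : CompId} {P : ProcId}
    {e : Expr} (h : (backTranslate m I).findProc C P = some e) :
    I.Declares C ∧ e = bodyOf m.events C P := by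
  simp only [Program.findProc, backTranslate, Option.bind_eq_some_iff,
    Option.map_eq_some_iff] at h
  obtain ⟨_, ⟨ci, hC, rfl⟩, hP⟩ := h
  refine ⟨by simp [Interface.Declares, hC], ?_⟩
  simp only [procsOf] at hP
  split_ifs at hP
  exact (Option.some.inj hP).symm

theorem dispatch_wellFormed {p : Program} {C : CompId} {P : ProcId} {t : List Event}
    (hP : p.findProc C P ≠ none)
    (ht : ∀ C₁ P' n C', Event.call C₁ P' n C' ∈ t →
      p.findProc C' P' ≠ none ∧ p.iface.Imports C C' P') (i : ℕ) :
    (dispatch C P i t).WellFormed p C := by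
  induction t generalizing i with
  | nil => trivial
  | cons ev t ih =>
    have hev : (emit C P ev).WellFormed p C := by
      cases ev with
      | call C₁ P' n C' =>
        obtain ⟨h₁, h₂⟩ := ht C₁ P' n C' (by simp)
        -- Calls back into `C` are not excluded here, so the target must be both an existing
        -- procedure and an import. The self-call that follows only needs `P` to exist.
        exact ⟨⟨fun h => h ▸ h₁, fun _ => h₂, id⟩, fun _ => hP, fun h => (h rfl).elim, id⟩
      | ret => simp [emit, Expr.WellFormed, Value.IsPtr]
    have := ih (fun C₁ P' n C' h => ht C₁ P' n C' (List.mem_cons_of_mem _ h)) (i + 1)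
    simp [dispatch, clause, counter, Expr.WellFormed, Value.IsPtr, hev, this]

theorem backTranslate_satisfies {m : FinTrace} {I : Interface} (hI : I.Whole)
    (hm : ∀ C P n C', Event.call C P n C' ∈ m.events → I.Imports C C' P) :
    (backTranslate m I).Satisfies I := by
  refine ⟨⟨hI, fun C => ?_, fun C => ?_, fun C P h => ?_, ?_, fun C P e h => ?_,
    fun C buf h => ?_⟩, rfl⟩
  · simp [backTranslate, Interface.Declares]
  · simp [backTranslate, Interface.Declares]
  · simp [findProc_backTranslate_of_exports (I := I) h]
  · simp [findProc_backTranslate_main hI.main_declared]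
  · obtain ⟨-, rfl⟩ := of_findProc_backTranslate h
    refine dispatch_wellFormed (by simp [h]) (fun C₁ P' n C' hmem => ?_) 0
    obtain ⟨hmem, hsrc⟩ := List.mem_filter.1 hmem
    have hC : C₁ = C := of_decide_eq_true hsrc
    have himp := hm C₁ P' n C' hmem
    rw [hC] at himp
    exact ⟨by simp [findProc_backTranslate_of_exports (hI.closed _ _ _ himp)], himp⟩
  · simp only [backTranslate, Option.map_eq_some_iff] at h
    obtain ⟨_, _, rfl⟩ := h
    simp [Value.IsPtr]

/-! Executions of the back-translation. -/

/-- The number of events of `t` that component `C` emits. -/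
def emitted (t : List Event) (C : CompId) : ℕ := (t.filter (fun ev => ev.source = C)).length

/-- Each component declared by `I` has only its buffer, which holds the number of events of `t` that
the component emits. -/
def Counts (I : Interface) (t : List Event) (mem : Memory) : Prop :=
  ∀ C, I.Declares C → mem C = [[.int (emitted t C)]]

theorem load_counter {mem : Memory} {C : CompId} {v : Value} (h : mem C = [[v]]) :
    mem.load ⟨C, .data 0, 0⟩ = some v := by
  simp [Memory.load, h]

theorem store_counter {mem : Memory} {C : CompId} {v : Value} (h : mem C = [[v]]) (w : Value) :
    mem.store ⟨C, .data 0, 0⟩ w = some (Function.update mem C [[w]]) := by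
  simp [Memory.store, load_counter h, h]

/-! ### Running the chain of clauses. -/

section Dispatch

variable {p : Program} {C : CompId} {σ : List Frame} {mem : Memory} {k : Cont} {a : Value}

/-- The test common to both branches: it reads the counter and leaves the memory unchanged. -/
theorem star_clause_guard {i c : ℕ} {e₁ e₂ s t} (h : mem C = [[.int c]])
    (hs : p.lts.Star ⟨C, σ, mem, .cond
        (.seq (.assign counter (.binop .add (.deref counter) (.val (.int 1)))) e₁) e₂ k,
      .val (.ofProp ((c : ℤ) = i)), a⟩ t s) :
    p.lts.Star ⟨C, σ, mem, k, clause i e₁ e₂, a⟩ t s :=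
  .silent .cond <| .silent .binop <| .silent .deref <| .silent .localBuf <|
    .silent (.derefEnd rfl (load_counter h)) <| .silent .binop₁ <| .silent .binop₂ hs

theorem star_clause_eq {i : ℕ} {e₁ e₂ s t} (h : mem C = [[.int i]])
    (hs : p.lts.Star ⟨C, σ, Function.update mem C [[.int (i + 1)]], k, e₁, a⟩ t s) :
    p.lts.Star ⟨C, σ, mem, k, clause i e₁ e₂, a⟩ t s := by
  refine star_clause_guard h ?_
  rw [Value.ofProp, if_pos rfl]
  -- The right-hand side of the increment is evaluated before the pointer to the buffer, so the old
  -- counter is read before the store.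
  exact .silent (.condTrue one_ne_zero) <| .silent .seq <| .silent .assign <| .silent .binop <|
    .silent .deref <| .silent .localBuf <| .silent (.derefEnd rfl (load_counter h)) <|
    .silent .binop₁ <| .silent .binop₂ <| .silent .assign₁ <| .silent .localBuf <|
    .silent (.assign₂ rfl (store_counter h _)) <| .silent .seqEnd hs

theorem star_clause_ne {i c : ℕ} {e₁ e₂ s t} (h : mem C = [[.int c]]) (hc : c ≠ i)
    (hs : p.lts.Star ⟨C, σ, mem, k, e₂, a⟩ t s) :
    p.lts.Star ⟨C, σ, mem, k, clause i e₁ e₂, a⟩ t s := by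
  refine star_clause_guard h ?_
  rw [Value.ofProp, if_neg (by exact_mod_cast hc)]
  exact .silent .condFalse hs

/-- The clauses of `l₁` all fail, because they test for values below the counter. The offset `i` is
general because each skipped clause raises the start of the remaining chain by one. -/
theorem star_dispatch_emit {P : ProcId} {i : ℕ} {l₁ l₂ : List Event} {ev : Event} {s t}
    (h : mem C = [[.int (i + l₁.length : ℕ)]])
    (hs : p.lts.Star ⟨C, σ, Function.update mem C [[.int (i + l₁.length + 1 : ℕ)]], k,
      emit C P ev, a⟩ t s) :
    p.lts.Star ⟨C, σ, mem, k, dispatch C P i (l₁ ++ ev :: l₂), a⟩ t s := by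
  induction l₁ generalizing i with
  | nil => exact star_clause_eq h (by simpa using hs)
  | cons e l₁ ih =>
    have hi : i + (e :: l₁).length = i + 1 + l₁.length := by simp; omega
    refine star_clause_ne h (by simp) (ih ?_ ?_)
    · rwa [← hi]
    · rwa [← hi]

theorem star_dispatch_exit {P : ProcId} {i : ℕ} {l : List Event}
    (h : mem C = [[.int (i + l.length : ℕ)]]) :
    p.lts.Star ⟨C, σ, mem, k, dispatch C P i l, a⟩ [] ⟨C, σ, mem, k, .exit, a⟩ := by
  induction l generalizing i with
  | nil => exact .refl _
  | cons e l ih =>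
    have hi : i + (e :: l).length = i + 1 + l.length := by simp; omega
    exact star_clause_ne h (by simp) (ih (by rwa [← hi]))

end Dispatch

/-! ### The invariant between two events. -/

/-- The call stacks that arise while component `C` has control and the components in the list wait
for a cross-component return. Each of them is about to call one of its own procedures; the
internal calls have nothing left to do. -/
inductive WaitingStack (p : Program) : CompId → List Frame → List CompId → Prop
  | nil {C} : WaitingStack p C [] []
  | internal {C a σ cs} : WaitingStack p C σ cs → WaitingStack p C (⟨C, a, .done⟩ :: σ) cs
  | external {C C' P a σ cs} : C ≠ C' → p.findProc C' P ≠ none → WaitingStack p C' σ cs →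
      WaitingStack p C (⟨C', a, .seq (.call C' P (.val (.int 0))) .done⟩ :: σ) (C' :: cs)

/-- Component `C` is about to execute the body of one of its procedures, the components in `cs` wait
for a return, and the counters record the events `t`. -/
inductive Ready (I : Interface) (p : Program) (t : List Event) (C : CompId) (cs : List CompId) :
    State → Prop
  | intro {σ mem P body a} : p.findProc C P = some body → WaitingStack p C σ cs →
      Counts I t mem → Ready I p t C cs ⟨C, σ, mem, .done, body, a⟩

theorem Counts.append {I : Interface} {t : List Event} {mem : Memory} (h : Counts I t mem)
    (e : Event) :
    Counts I (t ++ [e])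
      (Function.update mem e.source [[.int (emitted t e.source + 1 : ℕ)]]) := by
  intro C hC
  by_cases heq : C = e.source
  · subst heq; simp [emitted]
  · rw [Function.update_of_ne heq, h C hC]
    simp [emitted, Ne.symm heq]

/-- A return to the innermost waiting component, which then calls one of its own procedures. -/
theorem WaitingStack.star_ret {I : Interface} {p : Program} {t : List Event} {C C' : CompId}
    {σ : List Frame} {cs ds : List CompId} {mem : Memory} (h : WaitingStack p C σ ds)
    (hds : ds = C' :: cs) (hmem : Counts I t mem) (n : ℤ) (a : Value) :
    ∃ s, p.lts.Star ⟨C, σ, mem, .done, .val (.int n), a⟩ [.ret C n C'] s ∧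
      Ready I p t C' cs s := by
  -- Unwinding an internal frame restores the argument saved in it, so `a` must vary; the returned
  -- value `n` passes through unchanged.
  induction h generalizing a with
  | nil => cases hds
  | internal _ ih =>
    obtain ⟨s, hs, hr⟩ := ih hds _
    exact ⟨s, .silent .retInternal hs, hr⟩
  | external hne hP hσ =>
    cases hds
    obtain ⟨body, hbody⟩ := Option.ne_none_iff_exists'.1 hP
    -- The awakened frame discards the returned value and performs its self-call in tail position,
    -- so the frame pushed has continuation `.done`, as `WaitingStack.internal` requires.
    exact ⟨_, (LTS.Star.single (L := p.lts) (.retExternal hne)).trans <| .silent .seqEnd <|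
      .silent .call <| .silent (.callInternal hbody) <| .refl _, .intro hbody (.internal hσ) hmem⟩

/-! ### Emitting a well-formed trace. -/

section BackTranslate

variable {I : Interface} {m : FinTrace}

/-- Once all events of `m` are emitted, the counter of the component in control equals the length of
its chain of clauses, so every test fails. -/
theorem Ready.star_exit {C : CompId} {cs : List CompId} {s : State}
    (h : Ready I (backTranslate m I) m.events C cs s) :
    ∃ s', (backTranslate m I).lts.Star s [] s' ∧ Final s' := by
  obtain ⟨hP, _, hmem⟩ := h
  obtain ⟨hC, rfl⟩ := of_findProc_backTranslate hP
  exact ⟨_, star_dispatch_exit (by simpa [emitted] using hmem C hC), .inl rfl⟩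

/-- One event: the body of the current procedure dispatches to the code that emits it. -/
theorem Ready.star_event {t l : List Event} {e : Event} {C : CompId} {cs : List CompId} {s : State}
    (h : Ready I (backTranslate m I) t C cs s) (hm : m.events = t ++ e :: l) (hI : I.Whole)
    (himp : ∀ C P n C', Event.call C P n C' ∈ m.events → I.Imports C C' P)
    (hwb : WellBracketed C cs (e :: l)) :
    ∃ C' cs' s', (backTranslate m I).lts.Star s [e] s' ∧
      Ready I (backTranslate m I) (t ++ [e]) C' cs' s' ∧ WellBracketed C' cs' l := by
  obtain @⟨σ, mem, P, _, a, hP, hσ, hmem⟩ := h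
  obtain ⟨hC, rfl⟩ := of_findProc_backTranslate hP
  have hsrc : e.source = C := by
    cases e with
    | call => exact hwb.1
    | ret =>
      cases cs with
      | nil => exact hwb.elim
      | cons => exact hwb.1
  -- The chain splits at the clause of `e`; the number of clauses before it is the present value of
  -- the counter.
  have hbody : bodyOf m.events C P = dispatch C P 0
      (t.filter (fun ev => ev.source = C) ++ e :: l.filter (fun ev => ev.source = C)) := by
    simp [bodyOf, hm, hsrc]
  have hmem' := hmem.append e
  rw [hsrc] at hmem'
  rw [hbody]
  suffices ∃ C' cs' s', (backTranslate m I).lts.Star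
      ⟨C, σ, Function.update mem C [[.int (emitted t C + 1 : ℕ)]], .done, emit C P e, a⟩ [e] s' ∧
      Ready I (backTranslate m I) (t ++ [e]) C' cs' s' ∧ WellBracketed C' cs' l by
    obtain ⟨C', cs', s', hs, hr⟩ := this
    refine ⟨C', cs', s', star_dispatch_emit ?_ ?_, hr⟩
    · simpa [emitted] using hmem C hC
    · simpa [emitted] using hs
  cases e with
  | call C₁ P' n C' =>
    obtain ⟨rfl, hne, hwb⟩ := hwb
    have hi := himp C₁ P' n C' (by simp [hm])
    -- The interface is closed, so the imported procedure is exported by the callee and therefore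
    -- has a body.
    have hP' := findProc_backTranslate_of_exports (m := m) (hI.closed _ _ _ hi)
    refine ⟨C', C₁ :: cs, _, .silent .seq <| .silent .call <|
      LTS.Star.single (L := (backTranslate m I).lts) (.callExternal hne.symm hi hP'),
      .intro hP' (.external hne (by simp [hP]) hσ) hmem', hwb⟩
  | ret C₁ n C' =>
    cases cs with
    | nil => exact hwb.elim
    | cons D cs =>
      obtain ⟨rfl, rfl, hwb⟩ := hwb
      obtain ⟨s', hs, hr⟩ := hσ.star_ret rfl hmem' n a
      exact ⟨_, cs, s', hs, hr, hwb⟩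

/-- Induction on the initial segment `t`, extended by one event at its end; the remaining events `l`
stay well bracketed for the current component and its pending callers. -/
theorem exists_ready (hI : I.Whole) (hm : WellFormedTrace I m.events) {t l : List Event}
    (h : m.events = t ++ l) :
    ∃ s₀ s C cs, (backTranslate m I).Initial s₀ ∧ (backTranslate m I).lts.Star s₀ t s ∧
      Ready I (backTranslate m I) t C cs s ∧ WellBracketed C cs l := by
  induction t using List.reverseRecOn generalizing l with
  | nil =>
    have hmain := findProc_backTranslate_main (m := m) hI.main_declared
    refine ⟨_, _, mainComp, [], ⟨_, hmain, rfl⟩, .refl _, .intro hmain .nil ?_, ?_⟩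
    · intro C hC
      obtain ⟨ci, hci⟩ := Option.ne_none_iff_exists'.1 hC
      simp [Program.initMem, backTranslate, hci, emitted]
    · simpa [h] using hm.1
  | append_singleton t e ih =>
    have h' : m.events = t ++ e :: l := by simpa using h
    obtain ⟨s₀, s, C, cs, h₀, hs, hr, hwb⟩ := ih h'
    obtain ⟨C', cs', s', hs', hr', hwb'⟩ := hr.star_event h' hI hm.2 hwb
    exact ⟨s₀, s', C', cs', h₀, hs.trans hs', hr', hwb'⟩

theorem backTranslate_produces (hI : I.Whole) (hd : m.Defined)
    (hm : WellFormedTrace I m.events) : (backTranslate m I).lts.Produces m := by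
  obtain ⟨s₀, s, C, cs, h₀, hs, hr, -⟩ := exists_ready hI hm (List.append_nil _).symm
  obtain ⟨s', hs', hf⟩ := hr.star_exit
  -- One terminating trace serves both kinds of defined prefix: it extends the ongoing one and
  -- equals the terminated one.
  refine ⟨.terminates m.events, ?_, s₀, h₀, .terminates (by simpa using hs.trans hs') hf⟩
  cases m with
  | ongoing => exact List.prefix_rfl
  | terminated => rfl
  | undef => exact hd.elim

theorem backTranslate_countsEvents (hI : I.Whole) (hm : WellFormedTrace I m.events) :
    (backTranslate m I).CountsEvents m := by
  rintro t ⟨l, hl⟩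
  obtain ⟨s₀, s, C, cs, h₀, hs, ⟨_, _, hmem⟩, -⟩ := exists_ready hI hm hl.symm
  exact ⟨s₀, _, h₀, hs, fun D hD => load_counter (hmem D hD)⟩

end BackTranslate

end Source

end SecComp

theorem mainTheorem5 :
    SecComp.IsBackTranslation SecComp.Source.backTranslate ∧
    ∀ (I : SecComp.Interface) (m : SecComp.FinTrace),
      I.Whole → m.Defined → SecComp.WellFormedTrace I m.events →
        (SecComp.Source.backTranslate m I).Satisfies I ∧
        (SecComp.Source.backTranslate m I).lts.Produces m ∧
        (SecComp.Source.backTranslate m I).CountsEvents m := by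
  refine ⟨?_, fun I m hI hd hm => ⟨SecComp.Source.backTranslate_satisfies hI hm.2,
    SecComp.Source.backTranslate_produces hI hd hm,
    SecComp.Source.backTranslate_countsEvents hI hm⟩⟩
  rintro I P ⟨hP, rfl⟩ m hd hprod
  have hm := SecComp.Machine.wellFormedTrace_of_produces hd hprod
  exact ⟨SecComp.Source.backTranslate_satisfies hP.iface_whole hm.2,
    SecComp.Source.backTranslate_produces hP.iface_whole hd hm⟩
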